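/- **Subformula property of BPR.** Formulas are built from atoms (propositional variables and the units $\bot,\top$) with the binary connectives $\wedge,\vee,\to$ and co-implication $\mapsfrom$; the degree of a formula is the number of its binary connectives. BPR is the bilateral natural deduction system whose deductions end in a proof ($+$) or a refutation ($-$) of a formula and start from assumptions (taken as proved) and counterassumptions (taken as refuted). Write $\phi^+$, $\phi^-$ for a proof, a refutation of $\phi$; let $*$ be either sign, the same throughout a rule instance. The rules are as follows, where $[\phi^{\pm}]$ marks dischargeable hypotheses. * Introduction (I-)rules: $\phi^+,\psi^+/(\phi\wedge\psi)^+$; $\ \phi^+/(\phi\vee\psi)^+$; $\ \psi^+/(\phi\vee\psi)^+$; $\ [\phi^+]\ldots\psi^+/(\phi\to\psi)^+$; $\ \phi^+,\psi^- /(\phi\mapsfrom\psi)^+$; $\ \phi^-,\psi^- /(\phi\vee\psi)^-$; $\ \phi^- /(\phi\wedge\psi)^-$; $\ \psi^- /(\phi\wedge\psi)^-$; $\ [\psi^-]\ldots\phi^- /(\phi\mapsfrom\psi)^-$; $\ \phi^+,\psi^- /(\phi\to\psi)^-$. * Axioms: $\top^+$ and $\bot^-$. * Elimination (E-)rules, the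 first premise being the major one: $(\phi\wedge\psi)^+/\phi^+$ and $/\psi^+$; $\ (\phi\to\psi)^+,\phi^+/\psi^+$; $\ (\phi\mapsfrom\psi)^+/\phi^+$ and $/\psi^-$; $\ (\phi\vee\psi)^- /\phi^-$ and $/\psi^-$; $\ (\phi\mapsfrom\psi)^-,\psi^- /\phi^-$; $\ (\phi\to\psi)^- /\phi^+$ and $/\psi^-$; $\ E\vee(+)$: $(\phi\vee\psi)^+,\ [\phi^+]\ldots\chi^*,\ [\psi^+]\ldots\chi^*/\chi^*$; $\ E\wedge(-)$: $(\phi\wedge\psi)^-,\ [\phi^-]\ldots\chi^*,\ [\psi^-]\ldots\chi^*/\chi^*$. * Explosion rules: $\bot(+)$: $\bot^+/\chi^*$; $\ \top(-)$: $\top^- /\chi^*$; $\ PR(+)$ and $PR(-)$: $\phi^+,\phi^- /\chi^+$ and $\phi^+,\phi^- /\chi^-$. A *segment* of a deduction is a nonempty sequence of formula occurrences $\phi_1,\dots,\phi_n$ such that for every $i<n$, $\phi_i$ is a minor premise of an application of $E\vee(+)$ or $E\wedge(-)$ with conclusion $\phi_{i+1}$. It is *maximal* if $\phi_1$ is the conclusion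 of an I-rule and $\phi_n$ is the major premise of an E-rule; its degree is the degree of $\phi_1$ and its length is $n$. A deduction is in *pre-normal form* if all premises and conclusions of explosion rules have degree $0$ and no segment begins with the conclusion of an explosion rule and ends with a premise of an explosion rule. The *inductive value* of a deduction is the pair $\langle d,s\rangle$, where $d$ is the highest degree of a maximal segment ($0$ if there is none) and $s$ is the sum of the lengths of all maximal segments of degree $d$. A deduction is in *normal form* if it is in pre-normal form and has inductive value $\langle 0,0\rangle$. Then: 1. In every normal BPR deduction, every formula occurring is a subformula of the conclusion, of an undischarged assumption or of an undischarged counterassumption. 2. BPR has the subformula property: for all sets of formulas $\Gamma,\Delta$ and every formula $\phi$, if there is a BPR deduction proving (respectively refuting) $\phi$ with undischarged assumptions among $\Gamma$ and undischarged counterassumptions among $\Delta$, then there is a normal such deduction, and in it every formula occurring is a subformula of $\phi$ or of one of its undischarged assumptions or counterassumptions. -/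

import Mathlib

namespace BPR

/-- Propositional formulas over a set of propositional variables. The atoms in the wide sense are
the variables together with the units `bot` and `top`. -/
inductive Formula (Atom : Type*) : Type _
  | var (p : Atom) : Formula Atom
  | bot : Formula Atom
  | top : Formula Atom
  | and (A B : Formula Atom) : Formula Atom
  | or (A B : Formula Atom) : Formula Atom
  | imp (A B : Formula Atom) : Formula Atom
  /-- Co-implication: `coimp A B` is the formula `A ↤ B`, proved by proving `A` and refuting `B`. -/
  | coimp (A B : Formula Atom) : Formula Atom

namespace Formula

/-- The degree of a formula: the number of binary connectives; atoms (units included) have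
degree `0`. -/
def degree {Atom : Type*} : Formula Atom → ℕ
  | var _ => 0
  | bot => 0
  | top => 0
  | and A B => A.degree + B.degree + 1
  | or A B => A.degree + B.degree + 1
  | imp A B => A.degree + B.degree + 1
  | coimp A B => A.degree + B.degree + 1

/-- The set of subformulas of a formula (the formula itself included). -/
def subformulas {Atom : Type*} : Formula Atom → Set (Formula Atom)
  | var p => {var p}
  | bot => {bot}
  | top => {top}
  | and A B => insert (and A B) (A.subformulas ∪ B.subformulas)
  | or A B => insert (or A B) (A.subformulas ∪ B.subformulas)
  | imp A B => insert (imp A B) (A.subformulas ∪ B.subformulas)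
  | coimp A B => insert (coimp A B) (A.subformulas ∪ B.subformulas)

end Formula

/-- The two kinds of derivations: proofs (single line, `+`) and refutations, that is, dual proofs
(double line, `-`). -/
inductive Mode : Type
  | proof : Mode
  | refut : Mode

/-- Natural deduction trees of the system BPR: `Deduction s A` is the type of deductions ending in a
proof (`s = proof`) or a refutation (`s = refut`) of `A`.

Every hypothesis carries a numerical label. An inference with a label `k` that may discharge
assumptions (counterassumptions) of shape `A` discharges exactly the occurrences of `A` above the
relevant premise that carry the label `k` and have not been discharged before. Thus vacuous,
partial and complete discharge are all possible.

The rules that are dotted in the usual presentation have a mode parameter `s`. -/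
inductive Deduction {Atom : Type*} : Mode → Formula Atom → Type _
  /-- An assumption (`s = proof`) or a counterassumption (`s = refut`) with its label. -/
  | hyp (k : ℕ) (s : Mode) (A : Formula Atom) : Deduction s A
  -- proof rules
  | topI : Deduction .proof (.top : Formula Atom)
  | andI {A B : Formula Atom} (d : Deduction .proof A) (e : Deduction .proof B) :
      Deduction .proof (.and A B)
  | andE1 {A B : Formula Atom} (d : Deduction .proof (.and A B)) : Deduction .proof A
  | andE2 {A B : Formula Atom} (d : Deduction .proof (.and A B)) : Deduction .proof B
  | orI1 {A : Formula Atom} (B : Formula Atom) (d : Deduction .proof A) :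
      Deduction .proof (.or A B)
  | orI2 (A : Formula Atom) {B : Formula Atom} (d : Deduction .proof B) :
      Deduction .proof (.or A B)
  /-- Disjunction elimination; `A` is discharged in `e` and `B` in `f`. -/
  | orE (k : ℕ) {A B : Formula Atom} {s : Mode} {C : Formula Atom}
      (d : Deduction .proof (.or A B)) (e : Deduction s C) (f : Deduction s C) : Deduction s C
  /-- Implication introduction; the assumption `A` is discharged. -/
  | impI (k : ℕ) (A : Formula Atom) {B : Formula Atom} (d : Deduction .proof B) :
      Deduction .proof (.imp A B)
  | impE {A B : Formula Atom} (d : Deduction .proof (.imp A B)) (e : Deduction .proof A) :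
      Deduction .proof B
  | coimpI {A B : Formula Atom} (d : Deduction .proof A) (e : Deduction .refut B) :
      Deduction .proof (.coimp A B)
  | coimpE1 {A B : Formula Atom} (d : Deduction .proof (.coimp A B)) : Deduction .proof A
  | coimpE2 {A B : Formula Atom} (d : Deduction .proof (.coimp A B)) : Deduction .refut B
  -- refutation rules
  | botI' : Deduction .refut (.bot : Formula Atom)
  | orI' {A B : Formula Atom} (d : Deduction .refut A) (e : Deduction .refut B) :
      Deduction .refut (.or A B)
  | orE1' {A B : Formula Atom} (d : Deduction .refut (.or A B)) : Deduction .refut A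
  | orE2' {A B : Formula Atom} (d : Deduction .refut (.or A B)) : Deduction .refut B
  | andI1' {A : Formula Atom} (B : Formula Atom) (d : Deduction .refut A) :
      Deduction .refut (.and A B)
  | andI2' (A : Formula Atom) {B : Formula Atom} (d : Deduction .refut B) :
      Deduction .refut (.and A B)
  /-- Elimination of a refuted conjunction; the counterassumption `A` is discharged in `e` and `B`
  in `f`. -/
  | andE' (k : ℕ) {A B : Formula Atom} {s : Mode} {C : Formula Atom}
      (d : Deduction .refut (.and A B)) (e : Deduction s C) (f : Deduction s C) : Deduction s C
  /-- Introduction of a refuted co-implication; the counterassumption `B` is discharged. -/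
  | coimpI' (k : ℕ) {A : Formula Atom} (B : Formula Atom) (d : Deduction .refut A) :
      Deduction .refut (.coimp A B)
  | coimpE' {A B : Formula Atom} (d : Deduction .refut (.coimp A B)) (e : Deduction .refut B) :
      Deduction .refut A
  | impI' {A B : Formula Atom} (d : Deduction .proof A) (e : Deduction .refut B) :
      Deduction .refut (.imp A B)
  | impE1' {A B : Formula Atom} (d : Deduction .refut (.imp A B)) : Deduction .proof A
  | impE2' {A B : Formula Atom} (d : Deduction .refut (.imp A B)) : Deduction .refut B
  -- the explosion rules: from a proof of `⊥`, from a refutation of `⊤`, and the coordination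
  -- rules `PR(+)` (`s = proof`) and `PR(-)` (`s = refut`)
  | botE (s : Mode) (C : Formula Atom) (d : Deduction .proof (.bot : Formula Atom)) : Deduction s C
  | topE' (s : Mode) (C : Formula Atom) (d : Deduction .refut (.top : Formula Atom)) : Deduction s C
  | pr (s : Mode) (C : Formula Atom) {A : Formula Atom} (d : Deduction .proof A)
      (e : Deduction .refut A) : Deduction s C

namespace Deduction

/-- The undischarged hypotheses of a deduction: label, mode and formula. -/
def openHyps {Atom : Type*} :
    {s : Mode} → {A : Formula Atom} → Deduction s A → Set (ℕ × Mode × Formula Atom)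
  | _, _, hyp k s A => {(k, s, A)}
  | _, _, topI => ∅
  | _, _, andI d e => d.openHyps ∪ e.openHyps
  | _, _, andE1 d => d.openHyps
  | _, _, andE2 d => d.openHyps
  | _, _, orI1 _ d => d.openHyps
  | _, _, orI2 _ d => d.openHyps
  | _, _, @orE _ k A B _ _ d e f =>
      d.openHyps ∪ (e.openHyps \ {(k, .proof, A)}) ∪ (f.openHyps \ {(k, .proof, B)})
  | _, _, impI k A d => d.openHyps \ {(k, .proof, A)}
  | _, _, impE d e => d.openHyps ∪ e.openHyps
  | _, _, coimpI d e => d.openHyps ∪ e.openHyps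
  | _, _, coimpE1 d => d.openHyps
  | _, _, coimpE2 d => d.openHyps
  | _, _, botI' => ∅
  | _, _, orI' d e => d.openHyps ∪ e.openHyps
  | _, _, orE1' d => d.openHyps
  | _, _, orE2' d => d.openHyps
  | _, _, andI1' _ d => d.openHyps
  | _, _, andI2' _ d => d.openHyps
  | _, _, @andE' _ k A B _ _ d e f =>
      d.openHyps ∪ (e.openHyps \ {(k, .refut, A)}) ∪ (f.openHyps \ {(k, .refut, B)})
  | _, _, coimpI' k B d => d.openHyps \ {(k, .refut, B)}
  | _, _, coimpE' d e => d.openHyps ∪ e.openHyps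
  | _, _, impI' d e => d.openHyps ∪ e.openHyps
  | _, _, impE1' d => d.openHyps
  | _, _, impE2' d => d.openHyps
  | _, _, botE _ _ d => d.openHyps
  | _, _, topE' _ _ d => d.openHyps
  | _, _, pr _ _ d e => d.openHyps ∪ e.openHyps

/-- The undischarged assumptions of a deduction. -/
def assumptions {Atom : Type*} {s : Mode} {A : Formula Atom} (d : Deduction s A) :
    Set (Formula Atom) :=
  {B | ∃ k, (k, Mode.proof, B) ∈ d.openHyps}

/-- The undischarged counterassumptions of a deduction. -/
def counterassumptions {Atom : Type*} {s : Mode} {A : Formula Atom} (d : Deduction s A) :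
    Set (Formula Atom) :=
  {B | ∃ k, (k, Mode.refut, B) ∈ d.openHyps}

/-- The conclusion of a deduction. -/
def conclusion {Atom : Type*} {s : Mode} {A : Formula Atom} (_ : Deduction s A) : Formula Atom := A

/-- The formulas occurring in a deduction (at its leaves, discharged or not, as its conclusion, or
in between). -/
def formulas {Atom : Type*} : {s : Mode} → {A : Formula Atom} → Deduction s A → Set (Formula Atom)
  | _, _, hyp _ _ A => {A}
  | _, _, topI => {.top}
  | _, _, andI d e => insert (andI d e).conclusion (d.formulas ∪ e.formulas)
  | _, _, andE1 d => insert (andE1 d).conclusion d.formulas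
  | _, _, andE2 d => insert (andE2 d).conclusion d.formulas
  | _, _, orI1 x d => insert (orI1 x d).conclusion d.formulas
  | _, _, orI2 x d => insert (orI2 x d).conclusion d.formulas
  | _, _, orE k d e f => insert (orE k d e f).conclusion (d.formulas ∪ e.formulas ∪ f.formulas)
  | _, _, impI k A d => insert (impI k A d).conclusion d.formulas
  | _, _, impE d e => insert (impE d e).conclusion (d.formulas ∪ e.formulas)
  | _, _, coimpI d e => insert (coimpI d e).conclusion (d.formulas ∪ e.formulas)
  | _, _, coimpE1 d => insert (coimpE1 d).conclusion d.formulas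
  | _, _, coimpE2 d => insert (coimpE2 d).conclusion d.formulas
  | _, _, botI' => {.bot}
  | _, _, orI' d e => insert (orI' d e).conclusion (d.formulas ∪ e.formulas)
  | _, _, orE1' d => insert (orE1' d).conclusion d.formulas
  | _, _, orE2' d => insert (orE2' d).conclusion d.formulas
  | _, _, andI1' x d => insert (andI1' x d).conclusion d.formulas
  | _, _, andI2' x d => insert (andI2' x d).conclusion d.formulas
  | _, _, andE' k d e f => insert (andE' k d e f).conclusion (d.formulas ∪ e.formulas ∪ f.formulas)
  | _, _, coimpI' k B d => insert (coimpI' k B d).conclusion d.formulas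
  | _, _, coimpE' d e => insert (coimpE' d e).conclusion (d.formulas ∪ e.formulas)
  | _, _, impI' d e => insert (impI' d e).conclusion (d.formulas ∪ e.formulas)
  | _, _, impE1' d => insert (impE1' d).conclusion d.formulas
  | _, _, impE2' d => insert (impE2' d).conclusion d.formulas
  | _, _, botE s C d => insert (botE s C d).conclusion d.formulas
  | _, _, topE' s C d => insert (topE' s C d).conclusion d.formulas
  | _, _, pr s C d e => insert (pr s C d e).conclusion (d.formulas ∪ e.formulas)

/-- Some segment begins with the conclusion of an explosion rule and ends with the conclusion of the
given deduction. Here a segment is a nonempty sequence of formula occurrences such that each of them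
except the last is a minor premise of `orE` or `andE'` and is followed by the conclusion of that
inference. -/
def EndsExplosionSegment {Atom : Type*} :
    {s : Mode} → {A : Formula Atom} → Deduction s A → Prop
  | _, _, botE _ _ _ => True
  | _, _, topE' _ _ _ => True
  | _, _, pr _ _ _ _ => True
  | _, _, orE _ _ e f => e.EndsExplosionSegment ∨ f.EndsExplosionSegment
  | _, _, andE' _ _ e f => e.EndsExplosionSegment ∨ f.EndsExplosionSegment
  | _, _, _ => False

/-- Pre-normal form: all premises and conclusions of explosion rules have degree `0`, and no segment
leads from the conclusion of an explosion rule to a premise of an explosion rule. (A segment of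
length one is a formula occurrence that is both the conclusion and a premise of such rules.) -/
def PreNormal {Atom : Type*} : {s : Mode} → {A : Formula Atom} → Deduction s A → Prop
  | _, _, hyp _ _ _ => True
  | _, _, topI => True
  | _, _, andI d e => d.PreNormal ∧ e.PreNormal
  | _, _, andE1 d => d.PreNormal
  | _, _, andE2 d => d.PreNormal
  | _, _, orI1 _ d => d.PreNormal
  | _, _, orI2 _ d => d.PreNormal
  | _, _, orE _ d e f => d.PreNormal ∧ e.PreNormal ∧ f.PreNormal
  | _, _, impI _ _ d => d.PreNormal
  | _, _, impE d e => d.PreNormal ∧ e.PreNormal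
  | _, _, coimpI d e => d.PreNormal ∧ e.PreNormal
  | _, _, coimpE1 d => d.PreNormal
  | _, _, coimpE2 d => d.PreNormal
  | _, _, botI' => True
  | _, _, orI' d e => d.PreNormal ∧ e.PreNormal
  | _, _, orE1' d => d.PreNormal
  | _, _, orE2' d => d.PreNormal
  | _, _, andI1' _ d => d.PreNormal
  | _, _, andI2' _ d => d.PreNormal
  | _, _, andE' _ d e f => d.PreNormal ∧ e.PreNormal ∧ f.PreNormal
  | _, _, coimpI' _ _ d => d.PreNormal
  | _, _, coimpE' d e => d.PreNormal ∧ e.PreNormal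
  | _, _, impI' d e => d.PreNormal ∧ e.PreNormal
  | _, _, impE1' d => d.PreNormal
  | _, _, impE2' d => d.PreNormal
  | _, _, botE _ C d => C.degree = 0 ∧ ¬ d.EndsExplosionSegment ∧ d.PreNormal
  | _, _, topE' _ C d => C.degree = 0 ∧ ¬ d.EndsExplosionSegment ∧ d.PreNormal
  | _, _, @pr _ _ C A d e =>
      A.degree = 0 ∧ C.degree = 0 ∧ ¬ d.EndsExplosionSegment ∧ ¬ e.EndsExplosionSegment ∧
        d.PreNormal ∧ e.PreNormal

/-- The lengths of all segments that begin with the conclusion of an introduction rule and end with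
the conclusion of the given deduction. -/
def introSegments {Atom : Type*} : {s : Mode} → {A : Formula Atom} → Deduction s A → Multiset ℕ
  | _, _, andI _ _ => {1}
  | _, _, orI1 _ _ => {1}
  | _, _, orI2 _ _ => {1}
  | _, _, impI _ _ _ => {1}
  | _, _, coimpI _ _ => {1}
  | _, _, orI' _ _ => {1}
  | _, _, andI1' _ _ => {1}
  | _, _, andI2' _ _ => {1}
  | _, _, coimpI' _ _ _ => {1}
  | _, _, impI' _ _ => {1}
  | _, _, orE _ _ e f => (e.introSegments + f.introSegments).map (· + 1)
  | _, _, andE' _ _ e f => (e.introSegments + f.introSegments).map (· + 1)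
  | _, _, _ => 0

/-- The pairs (degree, length) for the maximal segments whose last formula is the conclusion of `d`,
provided that this conclusion is used as the major premise of an elimination rule. -/
def majorSegments {Atom : Type*} {s : Mode} {A : Formula Atom} (d : Deduction s A) :
    Multiset (ℕ × ℕ) :=
  d.introSegments.map fun l => (A.degree, l)

/-- The maximal segments of a deduction, each given by its degree and its length. A maximal segment
begins with the conclusion of an introduction rule and ends with the major premise of an
elimination rule. -/
def maximalSegments {Atom : Type*} :
    {s : Mode} → {A : Formula Atom} → Deduction s A → Multiset (ℕ × ℕ)
  | _, _, hyp _ _ _ => 0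
  | _, _, topI => 0
  | _, _, andI d e => d.maximalSegments + e.maximalSegments
  | _, _, andE1 d => d.majorSegments + d.maximalSegments
  | _, _, andE2 d => d.majorSegments + d.maximalSegments
  | _, _, orI1 _ d => d.maximalSegments
  | _, _, orI2 _ d => d.maximalSegments
  | _, _, orE _ d e f => d.majorSegments + d.maximalSegments + e.maximalSegments + f.maximalSegments
  | _, _, impI _ _ d => d.maximalSegments
  | _, _, impE d e => d.majorSegments + d.maximalSegments + e.maximalSegments
  | _, _, coimpI d e => d.maximalSegments + e.maximalSegments
  | _, _, coimpE1 d => d.majorSegments + d.maximalSegments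
  | _, _, coimpE2 d => d.majorSegments + d.maximalSegments
  | _, _, botI' => 0
  | _, _, orI' d e => d.maximalSegments + e.maximalSegments
  | _, _, orE1' d => d.majorSegments + d.maximalSegments
  | _, _, orE2' d => d.majorSegments + d.maximalSegments
  | _, _, andI1' _ d => d.maximalSegments
  | _, _, andI2' _ d => d.maximalSegments
  | _, _, andE' _ d e f => d.majorSegments + d.maximalSegments + e.maximalSegments + f.maximalSegments
  | _, _, coimpI' _ _ d => d.maximalSegments
  | _, _, coimpE' d e => d.majorSegments + d.maximalSegments + e.maximalSegments
  | _, _, impI' d e => d.maximalSegments + e.maximalSegments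
  | _, _, impE1' d => d.majorSegments + d.maximalSegments
  | _, _, impE2' d => d.majorSegments + d.maximalSegments
  | _, _, botE _ _ d => d.maximalSegments
  | _, _, topE' _ _ d => d.maximalSegments
  | _, _, pr _ _ d e => d.maximalSegments + e.maximalSegments

/-- The inductive value of a deduction: the pair of the highest degree of a maximal segment (`0` if
there is none) and the sum of the lengths of the maximal segments of that degree. -/
def inductiveValue {Atom : Type*} {s : Mode} {A : Formula Atom} (d : Deduction s A) : ℕ × ℕ :=
  let m := (d.maximalSegments.map Prod.fst).sup
  (m, ((d.maximalSegments.filter fun x => x.1 = m).map Prod.snd).sum)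

/-- Normal form: a deduction in pre-normal form with inductive value `(0, 0)`. -/
def Normal {Atom : Type*} {s : Mode} {A : Formula Atom} (d : Deduction s A) : Prop :=
  d.PreNormal ∧ d.inductiveValue = (0, 0)

/-- Every formula occurring in the deduction is a subformula of its conclusion, of an undischarged
assumption or of an undischarged counterassumption. -/
def IsAnalytic {Atom : Type*} {s : Mode} {A : Formula Atom} (d : Deduction s A) : Prop :=
  ∀ B ∈ d.formulas,
    B ∈ A.subformulas ∨ (∃ C ∈ d.assumptions, B ∈ C.subformulas) ∨
      ∃ C ∈ d.counterassumptions, B ∈ C.subformulas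

end Deduction

/-- `Derivable Γ Δ s A`: there is a deduction of `A` in mode `s` whose undischarged assumptions are
among `Γ` and whose undischarged counterassumptions are among `Δ`. -/
def Derivable {Atom : Type*} (Γ Δ : Set (Formula Atom)) (s : Mode) (A : Formula Atom) : Prop :=
  ∃ d : Deduction s A, d.assumptions ⊆ Γ ∧ d.counterassumptions ⊆ Δ

end BPR

namespace BPR

variable {Atom : Type*}

namespace Formula

/-! The first claim is an induction on deductions with a strengthened invariant,
`PreNormal.formulas_subset`. If the conclusion is not the end of a segment from an I-rule or an
explosion rule, then it is itself a subformula of an open hypothesis, unless it is $\top^+$ or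
$\bot^-$. Major premises of E-rules in a normal deduction are in this situation, so eliminations
only take apart open hypotheses.

The second claim is proved without reduction steps, by evaluating deductions in a model and reading
normal ones back. The worlds of a Beth model are the sets of signed formulas. Disjunctive forcing is
forcing along a tree of case distinctions over neutral deductions, some branches of which may end in
an explosion. BPR is sound for this model (`Forces.sound`). Forcing at a world yields a normal
deduction from it, and a neutral deduction yields forcing
(`Forces.normalDerivable_and_of_neutralDerivable`). At the world of its own open hypotheses, every
deduction thus has a normal counterpart. -/

theorem mem_subformulas_self (A : Formula Atom) : A ∈ A.subformulas := by
  cases A <;> simp [subformulas]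

theorem subformulas_trans {A B C : Formula Atom} (h : A ∈ B.subformulas)
    (h' : B ∈ C.subformulas) : A ∈ C.subformulas := by
  induction C <;> simp only [subformulas, Set.mem_insert_iff, Set.mem_union,
    Set.mem_singleton_iff] at h' ⊢ <;> grind [subformulas]

end Formula

/-- The subformulas of the formulas of a set of labelled hypotheses. -/
def hypSubformulas (H : Set (ℕ × Mode × Formula Atom)) : Set (Formula Atom) :=
  {B | ∃ h ∈ H, B ∈ h.2.2.subformulas}

theorem hypSubformulas_trans {H : Set (ℕ × Mode × Formula Atom)} {A B : Formula Atom}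
    (h : A ∈ B.subformulas) (h' : B ∈ hypSubformulas H) : A ∈ hypSubformulas H :=
  let ⟨x, hx, hB⟩ := h'
  ⟨x, hx, Formula.subformulas_trans h hB⟩

theorem hypSubformulas_union (H K : Set (ℕ × Mode × Formula Atom)) :
    hypSubformulas (H ∪ K) = hypSubformulas H ∪ hypSubformulas K := by
  ext B
  simp only [hypSubformulas, Set.mem_union, Set.mem_ofPred_eq]
  grind

theorem mem_hypSubformulas_diff {H : Set (ℕ × Mode × Formula Atom)} {k : ℕ} {s : Mode}
    {A B : Formula Atom} (h : B ∈ hypSubformulas H) :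
    B ∈ hypSubformulas (H \ {(k, s, A)}) ∨ B ∈ A.subformulas := by
  obtain ⟨x, hx, hB⟩ := h
  by_cases hxA : x = (k, s, A)
  · subst hxA
    exact Or.inr hB
  · exact Or.inl ⟨x, ⟨hx, hxA⟩, hB⟩

/-! ### Segments, and analyticity of normal deductions. -/

namespace Deduction

theorem one_le_of_mem_introSegments {s : Mode} {A : Formula Atom} (d : Deduction s A) :
    ∀ l ∈ d.introSegments, 1 ≤ l := by
  cases d <;> simp [introSegments] <;> grind

theorem one_le_of_mem_majorSegments {s : Mode} {A : Formula Atom} (d : Deduction s A) :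
    ∀ x ∈ d.majorSegments, 1 ≤ x.2 := by
  intro x hx
  obtain ⟨l, hl, rfl⟩ := Multiset.mem_map.1 hx
  exact d.one_le_of_mem_introSegments l hl

theorem one_le_of_mem_maximalSegments {s : Mode} {A : Formula Atom} (d : Deduction s A) :
    ∀ x ∈ d.maximalSegments, 1 ≤ x.2 := by
  induction d <;> simp only [maximalSegments, Multiset.mem_add, Multiset.notMem_zero] <;>
    rintro x hx <;> have := fun {s} {A : Formula Atom} (d : Deduction s A) => one_le_of_mem_majorSegments d x <;>
    grind

/-- If the highest degree is $0$, every maximal segment enters the sum of lengths. That sum vanishes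
only if there are no segments, because each has length at least $1$. -/
theorem inductiveValue_eq_zero_iff {s : Mode} {A : Formula Atom} (d : Deduction s A) :
    d.inductiveValue = (0, 0) ↔ d.maximalSegments = 0 := by
  constructor
  · intro h
    simp only [inductiveValue, Prod.mk.injEq] at h
    obtain ⟨h0, h1⟩ := h
    rw [h0] at h1
    refine Multiset.eq_zero_of_forall_notMem fun x hx => ?_
    have hx0 : x.1 = 0 := by
      have := Multiset.le_sup (Multiset.mem_map_of_mem Prod.fst hx)
      omega
    have := Multiset.single_le_sum (fun _ _ => Nat.zero_le _) _
      (Multiset.mem_map_of_mem Prod.snd (Multiset.mem_filter (p := fun x : ℕ × ℕ => x.1 = 0).2 ⟨hx, hx0⟩))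
    have := d.one_le_of_mem_maximalSegments x hx
    omega
  · intro h
    simp [inductiveValue, h]

theorem majorSegments_eq_zero_iff {s : Mode} {A : Formula Atom} (d : Deduction s A) :
    d.majorSegments = 0 ↔ d.introSegments = 0 := by
  simp [majorSegments]

/-- All members of a segment are the same formula, and pre-normality makes its first one atomic.
Hence no explosion segment ends in the compound major premise of an E-rule. -/
theorem PreNormal.degree_eq_zero {s : Mode} {A : Formula Atom} {d : Deduction s A}
    (h : d.PreNormal) (he : d.EndsExplosionSegment) : A.degree = 0 := by
  induction d <;> simp only [PreNormal, EndsExplosionSegment] at h he <;> grind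

theorem introSegments_eq_zero {s : Mode} {A : Formula Atom} (d : Deduction s A)
    (h : A.degree = 0) : d.introSegments = 0 := by
  induction d <;> simp_all [introSegments, Formula.degree]

/-- In a deduction in pre-normal form without maximal segments, every formula is a subformula of the
conclusion or of an open hypothesis; the first alternative is only needed if a segment from an
introduction or explosion rule, or an axiom, ends in the conclusion. -/
theorem PreNormal.formulas_subset {s : Mode} {A : Formula Atom} {d : Deduction s A}
    (h : d.PreNormal) (hm : d.maximalSegments = 0) :
    (∀ B ∈ d.formulas, B ∈ A.subformulas ∨ B ∈ hypSubformulas d.openHyps) ∧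
      (d.introSegments = 0 → ¬ d.EndsExplosionSegment →
        A ∈ hypSubformulas d.openHyps ∨ (s = .proof ∧ A = .top) ∨ (s = .refut ∧ A = .bot)) := by
  induction d
  case hyp k s A =>
    simp [formulas, openHyps, hypSubformulas, Formula.mem_subformulas_self]
  all_goals
    simp only [PreNormal, maximalSegments, formulas, introSegments, EndsExplosionSegment,
      openHyps, majorSegments_eq_zero_iff, Multiset.map_eq_zero, add_eq_zero, Multiset.singleton_ne_zero,
      hypSubformulas_union, conclusion, Set.mem_insert_iff, Set.mem_union] at h hm ⊢
    -- The major premise of an E-rule is compound, with no maximal or explosion segment ending in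
    -- it, so the second part of the induction hypothesis puts it below an open hypothesis. This
    -- accounts for the conclusion of a proper elimination, for the minor premises of `impE` and
    -- `coimpE'`, and for the formulas discharged by `orE` and `andE'`. Premises of explosion rules
    -- are atomic, so no I-segment ends in them, and again the second part applies. In `pr` the
    -- exceptional cases $\top^+$ and $\bot^-$ cannot both occur for one formula.
    grind (splits := 30) [Formula.mem_subformulas_self, Formula.subformulas_trans,
      hypSubformulas_trans, mem_hypSubformulas_diff, Formula.subformulas, Formula.degree, PreNormal.degree_eq_zero, introSegments_eq_zero]

end Deduction

/-! ### Normal and neutral derivability, and their closure under the rules. -/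

/-- Normal derivability of `A` in mode `s` from the signed formulas in `Γ`; all labels are `0`. -/
def NormalDerivable (Γ : Set (Mode × Formula Atom)) (s : Mode) (A : Formula Atom) : Prop :=
  ∃ d : Deduction s A, d.PreNormal ∧ d.maximalSegments = 0 ∧ ∀ h ∈ d.openHyps, h.1 = 0 ∧ h.2 ∈ Γ

/-- Normal derivability by a deduction in which no segment from an introduction or explosion rule
ends in the conclusion. -/
def NeutralDerivable (Γ : Set (Mode × Formula Atom)) (s : Mode) (A : Formula Atom) : Prop :=
  ∃ d : Deduction s A, d.PreNormal ∧ d.maximalSegments = 0 ∧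
    (∀ h ∈ d.openHyps, h.1 = 0 ∧ h.2 ∈ Γ) ∧ d.introSegments = 0 ∧ ¬ d.EndsExplosionSegment

section rules

variable {Γ Δ : Set (Mode × Formula Atom)} {s : Mode} {A B C : Formula Atom}

theorem NeutralDerivable.mono (h : NeutralDerivable Γ s A) (hΓ : Γ ⊆ Δ) :
    NeutralDerivable Δ s A :=
  let ⟨d, h1, h2, h3, h4⟩ := h
  ⟨d, h1, h2, fun x hx => ⟨(h3 x hx).1, hΓ (h3 x hx).2⟩, h4⟩

theorem NormalDerivable.mono (h : NormalDerivable Γ s A) (hΓ : Γ ⊆ Δ) : NormalDerivable Δ s A :=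
  let ⟨d, h1, h2, h3⟩ := h
  ⟨d, h1, h2, fun x hx => ⟨(h3 x hx).1, hΓ (h3 x hx).2⟩⟩

theorem NeutralDerivable.normalDerivable (h : NeutralDerivable Γ s A) : NormalDerivable Γ s A :=
  let ⟨d, h1, h2, h3, _⟩ := h
  ⟨d, h1, h2, h3⟩

theorem NeutralDerivable.hyp (h : (s, A) ∈ Γ) : NeutralDerivable Γ s A :=
  ⟨.hyp 0 s A, trivial, rfl, by simpa [Deduction.openHyps], rfl, id⟩

/-- With the single label `0`, a discharge removes every occurrence of the formula, so labelled
deductions behave like deductions from sets. -/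
theorem openHyps_diff_of_insert {H : Set (ℕ × Mode × Formula Atom)}
    (h : ∀ x ∈ H, x.1 = 0 ∧ x.2 ∈ insert (s, A) Γ) :
    ∀ x ∈ H \ {(0, s, A)}, x.1 = 0 ∧ x.2 ∈ Γ := by
  rintro ⟨k, t, B⟩ ⟨hx, hne⟩
  obtain ⟨rfl, h' | h'⟩ := h _ hx
  · exact absurd (congrArg (Prod.mk 0) h') hne
  · exact ⟨rfl, h'⟩

/-- Neutrality of the major premise prevents a new maximal segment. The conclusion starts a new
segment below an E-rule, so it is neutral again. The same holds for the other eliminations up to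
`NeutralDerivable.coimpE'`. -/
theorem NeutralDerivable.andE1 (h : NeutralDerivable Γ .proof (.and A B)) :
    NeutralDerivable Γ .proof A :=
  let ⟨d, h1, h2, h3, h4, _⟩ := h
  ⟨d.andE1, h1, by simp [Deduction.maximalSegments, Deduction.majorSegments, h2, h4], h3, rfl, id⟩

theorem NeutralDerivable.andE2 (h : NeutralDerivable Γ .proof (.and A B)) :
    NeutralDerivable Γ .proof B :=
  let ⟨d, h1, h2, h3, h4, _⟩ := h
  ⟨d.andE2, h1, by simp [Deduction.maximalSegments, Deduction.majorSegments, h2, h4], h3, rfl, id⟩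

theorem NeutralDerivable.coimpE1 (h : NeutralDerivable Γ .proof (.coimp A B)) :
    NeutralDerivable Γ .proof A :=
  let ⟨d, h1, h2, h3, h4, _⟩ := h
  ⟨d.coimpE1, h1, by simp [Deduction.maximalSegments, Deduction.majorSegments, h2, h4], h3, rfl, id⟩

theorem NeutralDerivable.coimpE2 (h : NeutralDerivable Γ .proof (.coimp A B)) :
    NeutralDerivable Γ .refut B :=
  let ⟨d, h1, h2, h3, h4, _⟩ := h
  ⟨d.coimpE2, h1, by simp [Deduction.maximalSegments, Deduction.majorSegments, h2, h4], h3, rfl, id⟩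

theorem NeutralDerivable.orE1' (h : NeutralDerivable Γ .refut (.or A B)) :
    NeutralDerivable Γ .refut A :=
  let ⟨d, h1, h2, h3, h4, _⟩ := h
  ⟨d.orE1', h1, by simp [Deduction.maximalSegments, Deduction.majorSegments, h2, h4], h3, rfl, id⟩

theorem NeutralDerivable.orE2' (h : NeutralDerivable Γ .refut (.or A B)) :
    NeutralDerivable Γ .refut B :=
  let ⟨d, h1, h2, h3, h4, _⟩ := h
  ⟨d.orE2', h1, by simp [Deduction.maximalSegments, Deduction.majorSegments, h2, h4], h3, rfl, id⟩

theorem NeutralDerivable.impE1' (h : NeutralDerivable Γ .refut (.imp A B)) :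
    NeutralDerivable Γ .proof A :=
  let ⟨d, h1, h2, h3, h4, _⟩ := h
  ⟨d.impE1', h1, by simp [Deduction.maximalSegments, Deduction.majorSegments, h2, h4], h3, rfl, id⟩

theorem NeutralDerivable.impE2' (h : NeutralDerivable Γ .refut (.imp A B)) :
    NeutralDerivable Γ .refut B :=
  let ⟨d, h1, h2, h3, h4, _⟩ := h
  ⟨d.impE2', h1, by simp [Deduction.maximalSegments, Deduction.majorSegments, h2, h4], h3, rfl, id⟩

theorem NeutralDerivable.impE (h : NeutralDerivable Γ .proof (.imp A B))
    (h' : NormalDerivable Γ .proof A) : NeutralDerivable Γ .proof B :=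
  let ⟨d, h1, h2, h3, h4, _⟩ := h
  let ⟨e, k1, k2, k3⟩ := h'
  ⟨d.impE e, ⟨h1, k1⟩,
    by simp [Deduction.maximalSegments, Deduction.majorSegments, h2, h4, k2],
    fun x hx => hx.elim (h3 x) (k3 x), rfl, id⟩

theorem NeutralDerivable.coimpE' (h : NeutralDerivable Γ .refut (.coimp A B))
    (h' : NormalDerivable Γ .refut B) : NeutralDerivable Γ .refut A :=
  let ⟨d, h1, h2, h3, h4, _⟩ := h
  let ⟨e, k1, k2, k3⟩ := h'
  ⟨d.coimpE' e, ⟨h1, k1⟩,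
    by simp [Deduction.maximalSegments, Deduction.majorSegments, h2, h4, k2],
    fun x hx => hx.elim (h3 x) (k3 x), rfl, id⟩

/-- Neutrality is lost here, since segments of the minor premises continue into the conclusion. -/
theorem NeutralDerivable.orE (h : NeutralDerivable Γ .proof (.or A B))
    (hA : NormalDerivable (insert (.proof, A) Γ) s C)
    (hB : NormalDerivable (insert (.proof, B) Γ) s C) : NormalDerivable Γ s C :=
  let ⟨d, h1, h2, h3, h4, _⟩ := h
  let ⟨e, k1, k2, k3⟩ := hA
  let ⟨f, l1, l2, l3⟩ := hB
  ⟨.orE 0 d e f, ⟨h1, k1, l1⟩,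
    by simp [Deduction.maximalSegments, Deduction.majorSegments, h2, h4, k2, l2],
    fun x hx => hx.elim (fun hx => hx.elim (h3 x) (openHyps_diff_of_insert k3 x))
      (openHyps_diff_of_insert l3 x)⟩

theorem NeutralDerivable.andE' (h : NeutralDerivable Γ .refut (.and A B))
    (hA : NormalDerivable (insert (.refut, A) Γ) s C)
    (hB : NormalDerivable (insert (.refut, B) Γ) s C) : NormalDerivable Γ s C :=
  let ⟨d, h1, h2, h3, h4, _⟩ := h
  let ⟨e, k1, k2, k3⟩ := hA
  let ⟨f, l1, l2, l3⟩ := hB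
  ⟨.andE' 0 d e f, ⟨h1, k1, l1⟩,
    by simp [Deduction.maximalSegments, Deduction.majorSegments, h2, h4, k2, l2],
    fun x hx => hx.elim (fun hx => hx.elim (h3 x) (openHyps_diff_of_insert k3 x))
      (openHyps_diff_of_insert l3 x)⟩

namespace NormalDerivable

theorem topI : NormalDerivable Γ .proof (.top : Formula Atom) :=
  ⟨.topI, trivial, rfl, fun _ h => h.elim⟩

theorem botI' : NormalDerivable Γ .refut (.bot : Formula Atom) :=
  ⟨.botI', trivial, rfl, fun _ h => h.elim⟩

theorem andI (h : NormalDerivable Γ .proof A) (h' : NormalDerivable Γ .proof B) :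
    NormalDerivable Γ .proof (.and A B) :=
  let ⟨d, h1, h2, h3⟩ := h
  let ⟨e, k1, k2, k3⟩ := h'
  ⟨d.andI e, ⟨h1, k1⟩, by simp [Deduction.maximalSegments, h2, k2],
    fun x hx => hx.elim (h3 x) (k3 x)⟩

theorem orI1 (h : NormalDerivable Γ .proof A) : NormalDerivable Γ .proof (.or A B) :=
  let ⟨d, h1, h2, h3⟩ := h
  ⟨d.orI1 B, h1, h2, h3⟩

theorem orI2 (h : NormalDerivable Γ .proof B) : NormalDerivable Γ .proof (.or A B) :=
  let ⟨d, h1, h2, h3⟩ := h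
  ⟨d.orI2 A, h1, h2, h3⟩

theorem impI (h : NormalDerivable (insert (.proof, A) Γ) .proof B) :
    NormalDerivable Γ .proof (.imp A B) :=
  let ⟨d, h1, h2, h3⟩ := h
  ⟨d.impI 0 A, h1, h2, openHyps_diff_of_insert h3⟩

theorem coimpI (h : NormalDerivable Γ .proof A) (h' : NormalDerivable Γ .refut B) :
    NormalDerivable Γ .proof (.coimp A B) :=
  let ⟨d, h1, h2, h3⟩ := h
  let ⟨e, k1, k2, k3⟩ := h'
  ⟨d.coimpI e, ⟨h1, k1⟩, by simp [Deduction.maximalSegments, h2, k2],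
    fun x hx => hx.elim (h3 x) (k3 x)⟩

theorem orI' (h : NormalDerivable Γ .refut A) (h' : NormalDerivable Γ .refut B) :
    NormalDerivable Γ .refut (.or A B) :=
  let ⟨d, h1, h2, h3⟩ := h
  let ⟨e, k1, k2, k3⟩ := h'
  ⟨d.orI' e, ⟨h1, k1⟩, by simp [Deduction.maximalSegments, h2, k2],
    fun x hx => hx.elim (h3 x) (k3 x)⟩

theorem andI1' (h : NormalDerivable Γ .refut A) : NormalDerivable Γ .refut (.and A B) :=
  let ⟨d, h1, h2, h3⟩ := h
  ⟨d.andI1' B, h1, h2, h3⟩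

theorem andI2' (h : NormalDerivable Γ .refut B) : NormalDerivable Γ .refut (.and A B) :=
  let ⟨d, h1, h2, h3⟩ := h
  ⟨d.andI2' A, h1, h2, h3⟩

theorem coimpI' (h : NormalDerivable (insert (.refut, B) Γ) .refut A) :
    NormalDerivable Γ .refut (.coimp A B) :=
  let ⟨d, h1, h2, h3⟩ := h
  ⟨d.coimpI' 0 B, h1, h2, openHyps_diff_of_insert h3⟩

theorem impI' (h : NormalDerivable Γ .proof A) (h' : NormalDerivable Γ .refut B) :
    NormalDerivable Γ .refut (.imp A B) :=
  let ⟨d, h1, h2, h3⟩ := h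
  let ⟨e, k1, k2, k3⟩ := h'
  ⟨d.impI' e, ⟨h1, k1⟩, by simp [Deduction.maximalSegments, h2, k2],
    fun x hx => hx.elim (h3 x) (k3 x)⟩

/-- Explosion with atomic conclusions suffices for explosion with arbitrary conclusions. -/
theorem of_degree_eq_zero
    (h : ∀ (s : Mode) (C : Formula Atom), C.degree = 0 → NormalDerivable Γ s C) (s : Mode)
    (C : Formula Atom) : NormalDerivable Γ s C := by
  induction C generalizing s with
  | var p => exact h s _ rfl
  | bot => exact h s _ rfl
  | top => exact h s _ rfl
  | and A B ihA ihB => cases s; exacts [andI (ihA _) (ihB _), andI1' (ihA _)]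
  | or A B ihA ihB => cases s; exacts [orI1 (ihA _), orI' (ihA _) (ihB _)]
  | imp A B ihA ihB =>
    cases s; exacts [impI ((ihB _).mono (Set.subset_insert _ _)), impI' (ihA _) (ihB _)]
  | coimp A B ihA ihB =>
    cases s; exacts [coimpI (ihA _) (ihB _), coimpI' ((ihA _).mono (Set.subset_insert _ _))]

end NormalDerivable

/-- Neutrality of the premise excludes a segment from one explosion rule to another. -/
theorem NeutralDerivable.botE (h : NeutralDerivable Γ .proof (.bot : Formula Atom)) (s : Mode)
    (C : Formula Atom) : NormalDerivable Γ s C :=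
  .of_degree_eq_zero (fun s C hC =>
    let ⟨d, h1, h2, h3, _, h5⟩ := h
    ⟨.botE s C d, ⟨hC, h5, h1⟩, h2, h3⟩) s C

theorem NeutralDerivable.topE' (h : NeutralDerivable Γ .refut (.top : Formula Atom)) (s : Mode)
    (C : Formula Atom) : NormalDerivable Γ s C :=
  .of_degree_eq_zero (fun s C hC =>
    let ⟨d, h1, h2, h3, _, h5⟩ := h
    ⟨.topE' s C d, ⟨hC, h5, h1⟩, h2, h3⟩) s C

theorem NeutralDerivable.pr (hA : A.degree = 0) (h : NeutralDerivable Γ .proof A)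
    (h' : NeutralDerivable Γ .refut A) (s : Mode) (C : Formula Atom) : NormalDerivable Γ s C :=
  .of_degree_eq_zero (fun s C hC =>
    let ⟨d, h1, h2, h3, _, h5⟩ := h
    let ⟨e, k1, k2, k3, _, k5⟩ := h'
    ⟨.pr s C d e, ⟨hA, hC, h5, k5, h1, k1⟩, by simp [Deduction.maximalSegments, h2, k2],
      fun x hx => hx.elim (h3 x) (k3 x)⟩) s C

end rules

/-! ### Trees of case distinctions. -/

/-- `Cover P Γ`: every branch of some tree of case distinctions over neutral deductions from `Γ`
ends in a context with the property `P` or in an explosion. -/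
inductive Cover (P : Set (Mode × Formula Atom) → Prop) : Set (Mode × Formula Atom) → Prop
  | base {Γ : Set (Mode × Formula Atom)} (h : P Γ) : Cover P Γ
  | or {Γ : Set (Mode × Formula Atom)} {A B : Formula Atom}
      (h : NeutralDerivable Γ .proof (.or A B)) (hA : Cover P (insert (.proof, A) Γ))
      (hB : Cover P (insert (.proof, B) Γ)) : Cover P Γ
  | and {Γ : Set (Mode × Formula Atom)} {A B : Formula Atom}
      (h : NeutralDerivable Γ .refut (.and A B)) (hA : Cover P (insert (.refut, A) Γ))
      (hB : Cover P (insert (.refut, B) Γ)) : Cover P Γ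
  | bot {Γ : Set (Mode × Formula Atom)} (h : NeutralDerivable Γ .proof .bot) : Cover P Γ
  | top {Γ : Set (Mode × Formula Atom)} (h : NeutralDerivable Γ .refut .top) : Cover P Γ
  | pr {Γ : Set (Mode × Formula Atom)} {A : Formula Atom} (hA : A.degree = 0)
      (h : NeutralDerivable Γ .proof A) (h' : NeutralDerivable Γ .refut A) : Cover P Γ

namespace Cover

variable {P Q : Set (Mode × Formula Atom) → Prop} {Γ Δ : Set (Mode × Formula Atom)}

/-- Trees are grafted onto the leaves of a tree. -/
theorem bind (h : Cover P Γ) (hPQ : ∀ Δ, Γ ⊆ Δ → P Δ → Cover Q Δ) : Cover Q Γ := by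
  induction h with
  | base h => exact hPQ _ subset_rfl h
  | or h _ _ ihA ihB =>
    exact .or h (ihA fun Δ hΔ => hPQ Δ ((Set.subset_insert _ _).trans hΔ))
      (ihB fun Δ hΔ => hPQ Δ ((Set.subset_insert _ _).trans hΔ))
  | and h _ _ ihA ihB =>
    exact .and h (ihA fun Δ hΔ => hPQ Δ ((Set.subset_insert _ _).trans hΔ))
      (ihB fun Δ hΔ => hPQ Δ ((Set.subset_insert _ _).trans hΔ))
  | bot h => exact .bot h
  | top h => exact .top h
  | pr hA h h' => exact .pr hA h h'

theorem map (h : Cover P Γ) (hPQ : ∀ Δ, Γ ⊆ Δ → P Δ → Q Δ) : Cover Q Γ :=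
  h.bind fun Δ hΔ hP => .base (hPQ Δ hΔ hP)

theorem mono (h : Cover P Γ) (hP : ∀ Γ Δ, Γ ⊆ Δ → P Γ → P Δ) (hΓ : Γ ⊆ Δ) : Cover P Δ := by
  induction h generalizing Δ with
  | base h => exact .base (hP _ _ hΓ h)
  | or h _ _ ihA ihB =>
    exact .or (h.mono hΓ) (ihA (Set.insert_subset_insert hΓ)) (ihB (Set.insert_subset_insert hΓ))
  | and h _ _ ihA ihB =>
    exact .and (h.mono hΓ) (ihA (Set.insert_subset_insert hΓ)) (ihB (Set.insert_subset_insert hΓ))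
  | bot h => exact .bot (h.mono hΓ)
  | top h => exact .top (h.mono hΓ)
  | pr hA h h' => exact .pr hA (h.mono hΓ) (h'.mono hΓ)

/-- The tree is read as a deduction: branchings become `orE` and `andE'`, and exploding branches end
in an explosion rule. -/
theorem normalDerivable {s : Mode} {A : Formula Atom} (h : Cover P Γ)
    (hP : ∀ Δ, Γ ⊆ Δ → P Δ → NormalDerivable Δ s A) : NormalDerivable Γ s A := by
  induction h with
  | base h => exact hP _ subset_rfl h
  | or h _ _ ihA ihB =>
    exact h.orE (ihA fun Δ hΔ => hP Δ ((Set.subset_insert _ _).trans hΔ))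
      (ihB fun Δ hΔ => hP Δ ((Set.subset_insert _ _).trans hΔ))
  | and h _ _ ihA ihB =>
    exact h.andE' (ihA fun Δ hΔ => hP Δ ((Set.subset_insert _ _).trans hΔ))
      (ihB fun Δ hΔ => hP Δ ((Set.subset_insert _ _).trans hΔ))
  | bot h => exact h.botE s A
  | top h => exact h.topE' s A
  | pr hA h h' => exact NeutralDerivable.pr hA h h' s A

end Cover

/-! ### The canonical Beth model. -/

/-- Forcing of signed formulas in the canonical Beth model, whose worlds are contexts. -/
def Forces : Formula Atom → Mode → Set (Mode × Formula Atom) → Prop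
  | .var p, s, Γ => Cover (fun Δ => NeutralDerivable Δ s (.var p)) Γ
  | .bot, .proof, Γ => Cover (fun _ => False) Γ
  | .bot, .refut, _ => True
  | .top, .proof, _ => True
  | .top, .refut, Γ => Cover (fun _ => False) Γ
  | .and A B, .proof, Γ => Forces A .proof Γ ∧ Forces B .proof Γ
  | .and A B, .refut, Γ => Cover (fun Δ => Forces A .refut Δ ∨ Forces B .refut Δ) Γ
  | .or A B, .proof, Γ => Cover (fun Δ => Forces A .proof Δ ∨ Forces B .proof Δ) Γ
  | .or A B, .refut, Γ => Forces A .refut Γ ∧ Forces B .refut Γ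
  | .imp A B, .proof, Γ => ∀ Δ, Γ ⊆ Δ → Forces A .proof Δ → Forces B .proof Δ
  | .imp A B, .refut, Γ => Forces A .proof Γ ∧ Forces B .refut Γ
  | .coimp A B, .proof, Γ => Forces A .proof Γ ∧ Forces B .refut Γ
  | .coimp A B, .refut, Γ => ∀ Δ, Γ ⊆ Δ → Forces B .refut Δ → Forces A .refut Δ

namespace Forces

theorem mono {A : Formula Atom} {s : Mode} {Γ Δ : Set (Mode × Formula Atom)} (h : Forces A s Γ)
    (hΓ : Γ ⊆ Δ) : Forces A s Δ := by
  induction A generalizing s Γ Δ with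
  | var p => exact Cover.mono h (fun _ _ hΓ h => h.mono hΓ) hΓ
  | bot => cases s; exacts [Cover.mono h (fun _ _ _ => id) hΓ, trivial]
  | top => cases s; exacts [trivial, Cover.mono h (fun _ _ _ => id) hΓ]
  | and A B ihA ihB =>
    cases s
    · exact ⟨ihA h.1 hΓ, ihB h.2 hΓ⟩
    · exact Cover.mono h (fun _ _ hΓ h => h.imp (ihA · hΓ) (ihB · hΓ)) hΓ
  | or A B ihA ihB =>
    cases s
    · exact Cover.mono h (fun _ _ hΓ h => h.imp (ihA · hΓ) (ihB · hΓ)) hΓ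
    · exact ⟨ihA h.1 hΓ, ihB h.2 hΓ⟩
  | imp A B ihA ihB =>
    cases s
    · exact fun Θ hΘ => h Θ (hΓ.trans hΘ)
    · exact ⟨ihA h.1 hΓ, ihB h.2 hΓ⟩
  | coimp A B ihA ihB =>
    cases s
    · exact ⟨ihA h.1 hΓ, ihB h.2 hΓ⟩
    · exact fun Θ hΘ => h Θ (hΓ.trans hΘ)

/-- Forcing is local: it may be checked on the leaves of a tree. This is what lets a case
distinction have an arbitrary conclusion. -/
theorem of_cover {A : Formula Atom} {s : Mode} {Γ : Set (Mode × Formula Atom)}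
    (h : Cover (Forces A s) Γ) : Forces A s Γ := by
  induction A generalizing s Γ with
  | var p => exact h.bind fun _ _ => id
  | bot => cases s; exacts [h.bind fun _ _ => id, trivial]
  | top => cases s; exacts [trivial, h.bind fun _ _ => id]
  | and A B ihA ihB =>
    cases s
    · exact ⟨ihA (h.map fun _ _ h => h.1), ihB (h.map fun _ _ h => h.2)⟩
    · exact h.bind fun _ _ => id
  | or A B ihA ihB =>
    cases s
    · exact h.bind fun _ _ => id
    · exact ⟨ihA (h.map fun _ _ h => h.1), ihB (h.map fun _ _ h => h.2)⟩
  | imp A B ihA ihB =>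
    cases s
    · exact fun Δ hΔ hA => ihB ((h.mono (fun _ _ hΓ h => h.mono hΓ) hΔ).map fun Θ hΘ h => h Θ subset_rfl (hA.mono hΘ))
    · exact ⟨ihA (h.map fun _ _ h => h.1), ihB (h.map fun _ _ h => h.2)⟩
  | coimp A B ihA ihB =>
    cases s
    · exact ⟨ihA (h.map fun _ _ h => h.1), ihB (h.map fun _ _ h => h.2)⟩
    · exact fun Δ hΔ hB => ihA ((h.mono (fun _ _ hΓ h => h.mono hΓ) hΔ).map fun Θ hΘ h => h Θ subset_rfl (hB.mono hΘ))

theorem exfalso {A : Formula Atom} {s : Mode} {Γ : Set (Mode × Formula Atom)}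
    (h : Cover (fun _ => False) Γ) : Forces A s Γ :=
  of_cover (h.map fun _ _ => False.elim)

/-- A clash on a compound formula descends to a clash on its components, ultimately to atoms. This
is why `Cover.pr` can be restricted to degree $0$, as pre-normality demands. -/
theorem not_both {A : Formula Atom} {Γ : Set (Mode × Formula Atom)} (h : Forces A .proof Γ)
    (h' : Forces A .refut Γ) : Cover (fun _ => False) Γ := by
  induction A generalizing Γ with
  | var p =>
    refine Cover.bind h fun Δ hΔ hp => ?_
    refine Cover.bind (h'.mono hΔ) fun Θ hΘ hp' => ?_
    exact .pr rfl (hp.mono hΘ) hp'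
  | bot => exact h
  | top => exact h'
  | and A B ihA ihB =>
    exact Cover.bind h' fun Δ hΔ hAB =>
      hAB.elim (ihA (h.1.mono hΔ)) (ihB (h.2.mono hΔ))
  | or A B ihA ihB =>
    exact Cover.bind h fun Δ hΔ hAB =>
      hAB.elim (ihA · (h'.1.mono hΔ)) (ihB · (h'.2.mono hΔ))
  | imp A B ihA ihB => exact ihB (h Γ subset_rfl h'.1) h'.2
  | coimp A B ihA ihB => exact ihA h.1 (h' Γ subset_rfl h.2)

/-- The two halves need each other. To read back a forced $(A\to B)^+$, the fresh hypothesis $A^+$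
must first be forced; to force a neutral $(A\to B)^+$, a forced $A^+$ must first be read back as the
minor premise. Refuted co-implication is dual. -/
theorem normalDerivable_and_of_neutralDerivable (A : Formula Atom) (s : Mode)
    (Γ : Set (Mode × Formula Atom)) :
    (Forces A s Γ → NormalDerivable Γ s A) ∧ (NeutralDerivable Γ s A → Forces A s Γ) := by
  induction A generalizing s Γ with
  | var p =>
    exact ⟨fun h => Cover.normalDerivable h fun _ _ h => h.normalDerivable, fun h => .base h⟩
  | bot =>
    cases s
    · exact ⟨fun h => Cover.normalDerivable h fun _ _ => False.elim, fun h => .bot h⟩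
    · exact ⟨fun _ => .botI', fun _ => trivial⟩
  | top =>
    cases s
    · exact ⟨fun _ => .topI, fun _ => trivial⟩
    · exact ⟨fun h => Cover.normalDerivable h fun _ _ => False.elim, fun h => .top h⟩
  | and A B ihA ihB =>
    cases s
    · exact ⟨fun h => .andI ((ihA _ _).1 h.1) ((ihB _ _).1 h.2),
        fun h => ⟨(ihA _ _).2 h.andE1, (ihB _ _).2 h.andE2⟩⟩
    · exact ⟨fun h => Cover.normalDerivable h fun _ _ h =>
          h.elim (fun h => .andI1' ((ihA _ _).1 h)) (fun h => .andI2' ((ihB _ _).1 h)),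
        fun h => .and h (.base (.inl ((ihA _ _).2 (.hyp (Set.mem_insert _ _)))))
          (.base (.inr ((ihB _ _).2 (.hyp (Set.mem_insert _ _)))))⟩
  | or A B ihA ihB =>
    cases s
    · exact ⟨fun h => Cover.normalDerivable h fun _ _ h =>
          h.elim (fun h => .orI1 ((ihA _ _).1 h)) (fun h => .orI2 ((ihB _ _).1 h)),
        fun h => .or h (.base (.inl ((ihA _ _).2 (.hyp (Set.mem_insert _ _)))))
          (.base (.inr ((ihB _ _).2 (.hyp (Set.mem_insert _ _)))))⟩
    · exact ⟨fun h => .orI' ((ihA _ _).1 h.1) ((ihB _ _).1 h.2),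
        fun h => ⟨(ihA _ _).2 h.orE1', (ihB _ _).2 h.orE2'⟩⟩
  | imp A B ihA ihB =>
    cases s
    · exact ⟨fun h => .impI ((ihB _ _).1 (h _ (Set.subset_insert _ _)
          ((ihA _ _).2 (.hyp (Set.mem_insert _ _))))),
        fun h Δ hΔ hA => (ihB _ _).2 ((h.mono hΔ).impE ((ihA _ _).1 hA))⟩
    · exact ⟨fun h => .impI' ((ihA _ _).1 h.1) ((ihB _ _).1 h.2),
        fun h => ⟨(ihA _ _).2 h.impE1', (ihB _ _).2 h.impE2'⟩⟩
  | coimp A B ihA ihB =>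
    cases s
    · exact ⟨fun h => .coimpI ((ihA _ _).1 h.1) ((ihB _ _).1 h.2),
        fun h => ⟨(ihA _ _).2 h.coimpE1, (ihB _ _).2 h.coimpE2⟩⟩
    · exact ⟨fun h => .coimpI' ((ihA _ _).1 (h _ (Set.subset_insert _ _)
          ((ihB _ _).2 (.hyp (Set.mem_insert _ _))))),
        fun h Δ hΔ hB => (ihA _ _).2 ((h.mono hΔ).coimpE' ((ihB _ _).1 hB))⟩

/-! ### Soundness of the model. -/

/-- This is the treatment of discharge: the discharged formula is forced at the larger world by
assumption, the remaining hypotheses by monotonicity. -/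
theorem of_diff {H : Set (ℕ × Mode × Formula Atom)} {Γ Δ : Set (Mode × Formula Atom)} {k : ℕ}
    {s : Mode} {A : Formula Atom} (h : ∀ x ∈ H \ {(k, s, A)}, Forces x.2.2 x.2.1 Γ) (hΓ : Γ ⊆ Δ)
    (hA : Forces A s Δ) : ∀ x ∈ H, Forces x.2.2 x.2.1 Δ := by
  intro x hx
  by_cases hxA : x = (k, s, A)
  · subst hxA
    exact hA
  · exact (h x ⟨hx, hxA⟩).mono hΓ

theorem sound {s : Mode} {A : Formula Atom} (d : Deduction s A) {Γ : Set (Mode × Formula Atom)}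
    (h : ∀ x ∈ d.openHyps, Forces x.2.2 x.2.1 Γ) : Forces A s Γ := by
  induction d generalizing Γ with
  | hyp k s A => exact h _ rfl
  | topI => trivial
  | botI' => trivial
  | andI d e ihd ihe | coimpI d e ihd ihe | orI' d e ihd ihe | impI' d e ihd ihe =>
    exact ⟨ihd fun x hx => h x (.inl hx), ihe fun x hx => h x (.inr hx)⟩
  | andE1 d ih | coimpE1 d ih | orE1' d ih | impE1' d ih => exact (ih h).1
  | andE2 d ih | coimpE2 d ih | orE2' d ih | impE2' d ih => exact (ih h).2
  | orI1 _ d ih | andI1' _ d ih => exact .base (.inl (ih h))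
  | orI2 _ d ih | andI2' _ d ih => exact .base (.inr (ih h))
  | orE k d e f ihd ihe ihf | andE' k d e f ihd ihe ihf =>
    -- The major premise only provides a tree with one of the two components forced at each leaf.
    -- The conclusion is obtained leaf by leaf and then glued.
    refine of_cover (Cover.map (ihd fun x hx => h x (.inl (.inl hx))) fun Δ hΔ hAB => ?_)
    exact hAB.elim (fun hA => ihe (of_diff (fun x hx => h x (.inl (.inr hx))) hΔ hA))
      (fun hB => ihf (of_diff (fun x hx => h x (.inr hx)) hΔ hB))
  | impI k A d ih | coimpI' k A d ih => exact fun Δ hΔ hA => ih (of_diff h hΔ hA)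
  | impE d e ihd ihe | coimpE' d e ihd ihe =>
    exact (ihd fun x hx => h x (.inl hx)) Γ subset_rfl (ihe fun x hx => h x (.inr hx))
  | botE s C d ih | topE' s C d ih => exact exfalso (ih h)
  | pr s C d e ihd ihe =>
    exact exfalso (not_both (ihd fun x hx => h x (.inl hx)) (ihe fun x hx => h x (.inr hx)))

end Forces

/-! ### Normal deductions from arbitrary ones. -/

/-- Every deduction can be replaced by a normal one from the same signed formulas. -/
theorem Deduction.normalDerivable {s : Mode} {A : Formula Atom} (d : Deduction s A) :
    NormalDerivable {x | ∃ k, (k, x) ∈ d.openHyps} s A :=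
  -- The world consists of the open hypotheses of `d` without their labels. Each is forced there
  -- because a bare hypothesis is a neutral deduction; soundness forces the conclusion, which is
  -- then read back.
  (Forces.normalDerivable_and_of_neutralDerivable A s _).1 <| Forces.sound d fun x hx =>
    (Forces.normalDerivable_and_of_neutralDerivable x.2.2 x.2.1 _).2 (.hyp ⟨x.1, hx⟩)

theorem Deduction.Normal.isAnalytic {s : Mode} {A : Formula Atom} {d : Deduction s A}
    (h : d.Normal) : d.IsAnalytic := by
  intro B hB
  refine ((h.1.formulas_subset (d.inductiveValue_eq_zero_iff.1 h.2)).1 B hB).imp_right ?_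
  rintro ⟨⟨k, t, C⟩, hC, hBC⟩
  cases t
  · exact .inl ⟨C, ⟨k, hC⟩, hBC⟩
  · exact .inr ⟨C, ⟨k, hC⟩, hBC⟩

end BPR

theorem mainTheorem5 {Atom : Type*} :
    (∀ (s : BPR.Mode) (A : BPR.Formula Atom) (d : BPR.Deduction s A), d.Normal → d.IsAnalytic) ∧
    (∀ (Γ Δ : Set (BPR.Formula Atom)) (s : BPR.Mode) (A : BPR.Formula Atom),
      BPR.Derivable Γ Δ s A →
        ∃ d : BPR.Deduction s A, d.Normal ∧ d.IsAnalytic ∧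
          d.assumptions ⊆ Γ ∧ d.counterassumptions ⊆ Δ) := by
  refine ⟨fun _ _ _ h => h.isAnalytic, fun Γ Δ s A ⟨d, hΓ, hΔ⟩ => ?_⟩
  obtain ⟨e, h1, h2, h3⟩ := d.normalDerivable
  have h : e.Normal := ⟨h1, e.inductiveValue_eq_zero_iff.2 h2⟩
  exact ⟨e, h, h.isAnalytic, fun B ⟨k, hB⟩ => hΓ (h3 _ hB).2, fun B ⟨k, hB⟩ => hΔ (h3 _ hB).2⟩
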